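/- Let $M$ be a non-empty closed oriented (topological) 3-manifold with a (possibly singular) triangulation: $M$ is homeomorphic to the quotient of a finite disjoint union of coherently oriented standard 3-simplices (the elements of $\Sigma^3$) by orientation-reversing simplicial pairings of their 2-dimensional faces, each face being paired with exactly one other face. (Faces of the same simplex may be paired with each other, and edges may be loops in $M$.) Each $\sigma\in\Sigma^3$ contains three normal quadrilaterals, one for each pair of opposite edges; the quadrilateral is said to face these two edges. If $\sigma$ has vertices $v_0,v_1,v_2,v_3$, in an order compatible with the orientation, and $q_k$ is the quadrilateral facing $v_0v_k$ and the opposite edge ($k=1,2,3$), let $\tau q_1=q_2$, $\tau q_2=q_3$, $\tau q_3=q_1$; this is independent of the choice of the order. Let $Q$ be the set of all normal quadrilaterals of all $\sigma\in\Sigma^3$. For an edge $e$ of the triangulation of $M$ and $q\in Q$, let $i(q,e)\in\{0,1,2\}$ be the number of edges facing $q$, in the simplex containing $q$, that are identified with $e$ in $M$. The parameter space $\mathcal P(M)$ is the set of all $Z=(z_q)\in(\mathbb C\setminus\{0,1\})^Q$ such that $$\prod_{q\in Q} z_q^{\,i(q,e)}=1\ \text{ for each edge } e,\qquad z_{\tau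 q}=\frac1{1-z_q}\ \text{ for each } q\in Q .$$ **Proposition.** For every $Z\in\mathcal P(M)$ there is at least one 3-simplex $\sigma\in\Sigma^3$ such that the three shape parameters $z_q$, $q\subset\sigma$, all lie in the closure of the lower half-plane $\{w\in\mathbb C:\operatorname{Im} w<0\}$. -/

import Mathlib

/-- Combinatorial data of a (possibly singular) triangulation without boundary, with coherently
oriented 3-simplices, made of tetrahedra indexed by `T`. Each tetrahedron is a copy of the standard
3-simplex with vertices `0, 1, 2, 3`, positively oriented in this order, and its face `i` is the
one opposite to the vertex `i`. The face `i` of `t` is glued to a face of `adj t i` by the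
simplicial map that sends each vertex `j ≠ i` to the vertex `glue t i j`; the value `glue t i i` is
then the vertex opposite to the target face. Two faces of one tetrahedron may be glued to each
other. -/
structure OrientedGluing (T : Type*) where
  adj : T → Fin 4 → T
  glue : T → Fin 4 → Equiv.Perm (Fin 4)
  /-- The face pairings are mutually inverse. -/
  adj_adj : ∀ t i, adj (adj t i) (glue t i i) = t
  glue_glue : ∀ t i, glue (adj t i) (glue t i i) = (glue t i)⁻¹
  /-- No face is paired with itself. -/
  ne_self : ∀ t i, (adj t i, glue t i i) ≠ (t, i)
  /-- The face pairings reverse the orientations induced on the faces. -/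
  odd : ∀ t i, Equiv.Perm.sign (glue t i) = -1

namespace OrientedGluing

variable {T : Type*} (G : OrientedGluing T)

/-- The face pairings, on the points of the disjoint union of standard 3-simplices (points are given
by their barycentric coordinates). -/
def PointRel (p q : Σ _ : T, stdSimplex ℝ (Fin 4)) : Prop :=
  ∃ i : Fin 4, p.2.1 i = 0 ∧ q.1 = G.adj p.1 i ∧ ∀ j, q.2.1 (G.glue p.1 i j) = p.2.1 j

/-- The quotient of the disjoint union of standard 3-simplices by the face pairings, with the
quotient topology. -/
abbrev Realization : Type _ := Quot G.PointRel

/-- The edges of the standard 3-simplex, as pairs of vertices. -/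
abbrev SimplexEdge : Type := {f : Finset (Fin 4) // f.card = 2}

/-- The face pairings, on the edges of the tetrahedra. -/
def EdgeRel (p q : T × SimplexEdge) : Prop :=
  ∃ i : Fin 4, i ∉ p.2.1 ∧ q.1 = G.adj p.1 i ∧ q.2.1 = p.2.1.map (G.glue p.1 i).toEmbedding

/-- The edges of the triangulation: edges of tetrahedra up to the identifications that are
generated by the face pairings. -/
abbrev Edge : Type _ := Quot G.EdgeRel

/-- The normal quadrilateral `k : Fin 3` of the standard 3-simplex faces the edge `{0, k + 1}` and
the opposite edge. -/
def Faces (k : Fin 3) (f : SimplexEdge) : Prop :=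
  f.1 = {0, k.succ} ∨ f.1 = ({0, k.succ} : Finset (Fin 4))ᶜ

/-- The cyclic order of the normal quadrilaterals in each tetrahedron. -/
def tau (q : T × Fin 3) : T × Fin 3 := (q.1, q.2 + 1)

/-- The index `i(q, e)`: the number of edges facing the quadrilateral `q` in its tetrahedron that
are identified with `e`. -/
noncomputable def index (q : T × Fin 3) (e : G.Edge) : ℕ :=
  Set.ncard {f : SimplexEdge | Faces q.2 f ∧ (Quot.mk _ (q.1, f) : G.Edge) = e}

/-- The parameter space: the solutions of the hyperbolic gluing equations, with one shape parameter
for each normal quadrilateral of each tetrahedron. -/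
def parameterSpace [Fintype T] : Set (T × Fin 3 → ℂ) :=
  {z | (∀ q, z q ≠ 0 ∧ z q ≠ 1) ∧
    (∀ e : G.Edge, ∏ q : T × Fin 3, z q ^ G.index q e = 1) ∧
    (∀ q, z (tau q) = 1 / (1 - z q))}

end OrientedGluing

/-- A (possibly singular) triangulation, with coherently oriented tetrahedra indexed by `T`, of the
space `M`. -/
structure OrientedTriangulation (T : Type*) (M : Type*) [TopologicalSpace M] extends
    OrientedGluing T where
  homeo : toOrientedGluing.Realization ≃ₜ M

/-!
The proof is by contradiction. A shape parameter `w` in the upper half-plane, together with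
`1 / (1 - w)` and `1 / (1 - 1 / (1 - w))`, gives the three angles of a Euclidean triangle as its
arguments. Hence, if no tetrahedron satisfies the conclusion, all shape parameters lie in the upper
half-plane, and their arguments are positive and add up to `π` in each tetrahedron. Each
quadrilateral faces two edges, so the total dihedral angle of a tetrahedron is `2π`, whereas the
edge equations say that the angles around an edge add up to a positive multiple of `2π`. Therefore
there are at most as many edges as tetrahedra (`OrientedGluing.card_edge_le_of_im_pos`).

On the other hand, a triangulated closed 3-manifold has more edges than tetrahedra
(`OrientedGluing.card_lt_card_edge`). With `m` tetrahedra, the vertex links together have `4 m`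
triangles and `6 m` edges, and their vertices are the directed edges of the triangulation. So the
claim is that the Euler characteristic of the links is positive, and for this it suffices that their
first cohomology vanishes (`OrientedGluing.two_mul_card_lt_card_linkVertex`).

That is the point where the manifold hypothesis enters
(`OrientedGluing.IsLinkCocycle.isLinkCoboundary`).
An integral 1-cocycle on the links defines a map from a punctured neighbourhood of each vertex,
which is an open cone on its link without the apex, to the circle. In a manifold this neighbourhood
contains a punctured ball of dimension three, on which every map to the circle lifts to the real
line (`exists_circle_lift_puncturedBall`); the values of the lift at the vertices of a small copy of
the link exhibit the cocycle as a coboundary. It is not necessary to know that the links are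
spheres.
-/

/-! ### Lifting maps from a punctured ball to the circle -/

/-- A continuous real function that is integral on a preconnected set is constant there. -/
theorem IsPreconnected.exists_int_eq {X : Type*} [TopologicalSpace X] {S : Set X}
    (hS : IsPreconnected S) {F : X → ℝ} (hF : ContinuousOn F S)
    (h : ∀ x ∈ S, (F x : AddCircle (1 : ℝ)) = 0) : ∃ n : ℤ, ∀ x ∈ S, F x = n := by
  rcases S.eq_empty_or_nonempty with rfl | ⟨a, ha⟩
  · exact ⟨0, by simp⟩
  have hint : Set.MapsTo F S (Set.range ((↑) : ℤ → ℝ)) := fun x hx ↦ by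
    obtain ⟨n, hn⟩ := AddCircle.coe_eq_zero_iff (1 : ℝ) |>.1 (h x hx)
    exact ⟨n, by simpa using hn⟩
  have : DiscreteTopology (Set.range ((↑) : ℤ → ℝ)) :=
    (Int.isClosedEmbedding_coe_real.isEmbedding.toHomeomorph.symm.isEmbedding).discreteTopology
  obtain ⟨n, hn⟩ := hint ha
  exact ⟨n, fun x hx ↦ (hS.constant_of_mapsTo (isDiscrete_iff_discreteTopology.2 this) hF hint
    hx ha).trans hn.symm⟩

section CircleLift

variable {E : Type*} [NormedAddCommGroup E] [NormedSpace ℝ E]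

theorem exists_circle_lift_of_starConvex {S : Set E} {a : E} (hS : StarConvex ℝ a S) (ha : a ∈ S)
    (ho : IsOpen S) {f : E → AddCircle (1 : ℝ)} (hf : ContinuousOn f S) :
    ∃ F : E → ℝ, ContinuousOn F S ∧ ∀ x ∈ S, (F x : AddCircle (1 : ℝ)) = f x := by
  classical
  have : ContractibleSpace S := hS.contractibleSpace ⟨a, ha⟩
  have : LocallyPathConnectedSpace S := ho.locallyPathConnectedSpace
  obtain ⟨e, he⟩ := QuotientAddGroup.mk_surjective (f a)
  obtain ⟨F, ⟨-, hF⟩, -⟩ := (AddCircle.isCoveringMap_coe (1 : ℝ)).existsUnique_continuousMap_lifts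
    ⟨S.domRestrict f, hf.domRestrict⟩ ⟨a, ha⟩ e he
  have hext : ∀ x : S, (fun x ↦ if h : x ∈ S then F ⟨x, h⟩ else 0 : E → ℝ) x = F x := by simp
  refine ⟨fun x ↦ if h : x ∈ S then F ⟨x, h⟩ else 0, ?_, fun x hx ↦ ?_⟩
  · rw [continuousOn_iff_continuous_domRestrict]
    exact F.continuous.congr fun x ↦ (hext x).symm
  · rw [hext ⟨x, hx⟩]
    exact congr_fun hF ⟨x, hx⟩

/-- In dimension at least three, the complement of a point is the union of two star-shaped open
sets (the complements of opposite rays) with connected intersection (the complement of a line);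
lifts over the two sets can therefore be matched. -/
theorem exists_circle_lift_compl_zero (hE : 2 < Module.finrank ℝ E)
    {f : E → AddCircle (1 : ℝ)} (hf : ContinuousOn f {0}ᶜ) :
    ∃ F : E → ℝ, ContinuousOn F {0}ᶜ ∧ ∀ x ≠ 0, (F x : AddCircle (1 : ℝ)) = f x := by
  classical
  have : FiniteDimensional ℝ E := .of_finrank_pos (by omega)
  have : Nontrivial E := Module.nontrivial_of_finrank_pos (R := ℝ) (by omega)
  obtain ⟨e, he⟩ := exists_ne (0 : E)
  let ray (w : E) : Set E := {x | ∃ t : ℝ, 0 ≤ t ∧ x = t • w}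
  have hopen (w : E) (hw : w ≠ 0) : IsOpen (ray w)ᶜ := by
    have : ray w = (fun t : ℝ ↦ t • w) '' Set.Ici 0 := by
      ext x; simp [ray, eq_comm]
    rw [this, isOpen_compl_iff]
    exact isClosedMap_smul_left w _ isClosed_Ici
  have hstar (w : E) (hw : w ≠ 0) : -w ∉ ray w ∧ StarConvex ℝ (-w) (ray w)ᶜ := by
    have h1 : -w ∉ ray w := by
      rintro ⟨t, ht, h⟩
      have : (t + 1) • w = 0 := by rw [add_smul, ← h]; simp
      rcases smul_eq_zero.1 this with h | h
      · linarith
      · exact hw h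
    refine ⟨h1, fun y hy a b ha hb hab ↦ ?_⟩
    rintro ⟨t, ht, h⟩
    rcases hb.eq_or_lt with rfl | hb
    · have ha1 : a = 1 := by linarith
      subst ha1
      exact h1 ⟨t, ht, by simpa using h⟩
    · refine hy ⟨b⁻¹ * (t + a), by positivity, ?_⟩
      rw [mul_smul, add_smul, ← h]
      simp [hb.ne']
  have hsub (w : E) : (ray w)ᶜ ⊆ {0}ᶜ := fun x hx h0 ↦ hx ⟨0, le_rfl, by simpa using h0⟩
  obtain ⟨F, hFc, hF⟩ := exists_circle_lift_of_starConvex (hstar e he).2 (hstar e he).1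
    (hopen e he) (hf.mono (hsub e))
  have he' : -e ≠ 0 := neg_ne_zero.2 he
  obtain ⟨G, hGc, hG⟩ := exists_circle_lift_of_starConvex (hstar _ he').2 (hstar _ he').1
    (hopen _ he') (hf.mono (hsub _))
  have hline : ((ℝ ∙ e : Submodule ℝ E) : Set E)ᶜ = (ray e)ᶜ ∩ (ray (-e))ᶜ := by
    ext x
    simp only [Set.mem_compl_iff, SetLike.mem_coe, Set.mem_inter_iff, ← not_or, not_iff_not,
      Submodule.mem_span_singleton]
    constructor
    · rintro ⟨t, rfl⟩
      rcases le_total 0 t with h | h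
      · exact .inl ⟨t, h, rfl⟩
      · exact .inr ⟨-t, by linarith, by simp⟩
    · rintro (⟨t, -, rfl⟩ | ⟨t, -, rfl⟩)
      · exact ⟨t, rfl⟩
      · exact ⟨-t, by simp⟩
  have hconn : IsPreconnected ((ray e)ᶜ ∩ (ray (-e))ᶜ) := by
    rw [← hline]
    refine (isConnected_compl_of_one_lt_codim ?_).isPreconnected
    rw [← Module.finrank_eq_rank]
    have h1 := Submodule.finrank_quotient_add_finrank (ℝ ∙ e : Submodule ℝ E)
    rw [finrank_span_singleton he] at h1
    exact_mod_cast (by omega : 1 < Module.finrank ℝ (E ⧸ (ℝ ∙ e : Submodule ℝ E)))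
  obtain ⟨n, hn⟩ := hconn.exists_int_eq (F := fun x ↦ F x - G x)
    ((hFc.mono Set.inter_subset_left).sub (hGc.mono Set.inter_subset_right)) fun x hx ↦ by
      rw [AddCircle.coe_sub, hF x hx.1, hG x hx.2, sub_self]
  have hmem (x : E) (hx : x ≠ 0) (h : x ∈ ray e) : x ∈ (ray (-e))ᶜ := by
    rintro ⟨s, hs, h'⟩
    obtain ⟨t, ht, rfl⟩ := h
    have : (t + s) • e = 0 := by rw [add_smul, h']; simp
    rcases smul_eq_zero.1 this with h | h
    · exact hx (by rw [show t = 0 by linarith, zero_smul])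
    · exact he h
  have hEq (x : E) (hx : x ∈ (ray (-e))ᶜ) :
      (if x ∈ ray e then G x + n else F x) = G x + n := by
    split_ifs with h
    · rfl
    · linarith [hn x ⟨h, hx⟩]
  refine ⟨fun x ↦ if x ∈ ray e then G x + n else F x, fun x hx ↦ ?_, fun x hx ↦ ?_⟩
  · by_cases h : x ∈ ray e
    · have hx' := hmem x hx h
      have hU := (hopen _ he').mem_nhds hx'
      refine ContinuousAt.continuousWithinAt ?_
      refine ((hGc.continuousAt hU).add_const (n : ℝ)).congr ?_
      filter_upwards [hU] with y hy using (hEq y hy).symm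
    · have hU := (hopen _ he).mem_nhds h
      refine ContinuousAt.continuousWithinAt ?_
      refine (hFc.continuousAt hU).congr ?_
      filter_upwards [hU] with y hy using (if_neg hy).symm
  · dsimp only
    split_ifs with h
    · rw [AddCircle.coe_add, hG x (hmem x hx h)]
      have : ((n : ℝ) : AddCircle (1 : ℝ)) = 0 := (AddCircle.coe_eq_zero_iff _).2 ⟨n, by simp⟩
      rw [this, add_zero]
    · exact hF x h

theorem exists_circle_lift_puncturedBall (hE : 2 < Module.finrank ℝ E) {c : E} {r : ℝ}
    (hr : 0 < r) {f : E → AddCircle (1 : ℝ)} (hf : ContinuousOn f (Metric.ball c r \ {c})) :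
    ∃ F : E → ℝ, ContinuousOn F (Metric.ball c r \ {c}) ∧
      ∀ x ∈ Metric.ball c r \ {c}, (F x : AddCircle (1 : ℝ)) = f x := by
  let φ : OpenPartialHomeomorph E E := OpenPartialHomeomorph.univBall c r
  have hφ0 : φ 0 = c := OpenPartialHomeomorph.univBall_apply_zero c r
  have hφt : φ.target = Metric.ball c r := OpenPartialHomeomorph.univBall_target c hr
  have hφs : φ.source = Set.univ := OpenPartialHomeomorph.univBall_source c r
  have hsymm : ∀ x ∈ Metric.ball c r \ {c}, φ.symm x ≠ 0 := fun x hx h ↦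
    hx.2 (by rw [Set.mem_singleton_iff, ← hφ0, ← h, φ.right_inv (hφt ▸ hx.1)])
  obtain ⟨F, hFc, hF⟩ := exists_circle_lift_compl_zero hE (f := f ∘ φ)
    (hf.comp (OpenPartialHomeomorph.continuous_univBall c r).continuousOn fun x hx ↦
      ⟨hφt ▸ φ.map_source (by simp [hφs]), fun h ↦ hx (φ.injOn (by simp [hφs]) (by simp [hφs])
        ((Set.mem_singleton_iff.1 h).trans hφ0.symm))⟩)
  refine ⟨F ∘ φ.symm, hFc.comp ((OpenPartialHomeomorph.continuousOn_univBall_symm c r).mono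
    Set.sdiff_subset) hsymm, fun x hx ↦ ?_⟩
  rw [Function.comp_apply, hF _ (hsymm x hx), Function.comp_apply, φ.right_inv (hφt ▸ hx.1)]

end CircleLift

namespace OrientedGluing

variable {T : Type*} (G : OrientedGluing T)

/-! ### The vertex links and their Euler characteristic -/

/-- The directed edges of the tetrahedra. The pair `(t, (v, j))` also encodes the vertex on the edge
`vj` of the normal triangle of `t` at `v`, as well as the edge of that triangle in the face `j`. -/
abbrev DirectedEdge (T : Type*) : Type _ := T × {p : Fin 4 × Fin 4 // p.1 ≠ p.2}

/-- The face pairings, on the vertices of the normal triangles of the tetrahedra. -/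
def LinkRel (p q : DirectedEdge T) : Prop :=
  ∃ i : Fin 4, p.2.1.1 ≠ i ∧ p.2.1.2 ≠ i ∧ q.1 = G.adj p.1 i ∧
    q.2.1.1 = G.glue p.1 i p.2.1.1 ∧ q.2.1.2 = G.glue p.1 i p.2.1.2

/-- The vertices of the vertex links, that is, the directed edges of the triangulation. -/
abbrev LinkVertex : Type _ := Quot G.LinkRel

/-- A function `h` on the vertices of the normal triangles, `h t v j` being its value at the vertex
on the edge `vj` of the triangle of `t` at `v`, whose differences along the edges of these triangles
are respected by the face pairings. These differences form a simplicial 1-cocycle on the vertex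
links, and every such cocycle is obtained in this way. The values `h t v v` are irrelevant. -/
def IsLinkCocycle {A : Type*} [AddCommGroup A] (h : T → Fin 4 → Fin 4 → A) : Prop :=
  ∀ t i v j k, v ≠ i → j ≠ v → j ≠ i → k ≠ v → k ≠ i →
    h t v j - h t v k = h (G.adj t i) (G.glue t i v) (G.glue t i j) -
      h (G.adj t i) (G.glue t i v) (G.glue t i k)

/-- The function `h` can be corrected by a constant on each normal triangle so as to be respected by
the face pairings. Equivalently, the 1-cocycle defined by `h` is the coboundary of a function on the
vertices of the links. -/
def IsLinkCoboundary {A : Type*} [AddCommGroup A] (h : T → Fin 4 → Fin 4 → A) : Prop :=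
  ∃ k : T → Fin 4 → A, ∀ t i v j, v ≠ i → j ≠ v → j ≠ i →
    h t v j + k t v = h (G.adj t i) (G.glue t i v) (G.glue t i j) +
      k (G.adj t i) (G.glue t i v)

/-- The face pairings, on the edges of the normal triangles. -/
def linkEdgeInv (x : DirectedEdge T) : DirectedEdge T :=
  (G.adj x.1 x.2.1.2, ⟨(G.glue x.1 x.2.1.2 x.2.1.1, G.glue x.1 x.2.1.2 x.2.1.2),
    fun h ↦ x.2.2 ((G.glue x.1 x.2.1.2).injective h)⟩)

theorem linkEdgeInv_involutive : Function.Involutive G.linkEdgeInv := by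
  rintro ⟨t, ⟨v, i⟩, h⟩
  simp [linkEdgeInv, G.adj_adj, G.glue_glue]

theorem linkEdgeInv_ne (x : DirectedEdge T) : G.linkEdgeInv x ≠ x := by
  obtain ⟨t, ⟨v, i⟩, h⟩ := x
  intro h'
  simp only [linkEdgeInv, Prod.mk.injEq, Subtype.mk.injEq] at h'
  exact G.ne_self t i (Prod.ext h'.1 h'.2.2)

theorem card_directedEdge [Fintype T] :
    Nat.card (DirectedEdge T) = 12 * Fintype.card T := by
  have : Fintype.card {p : Fin 4 × Fin 4 // p.1 ≠ p.2} = 12 := by decide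
  rw [Nat.card_prod, Nat.card_eq_fintype_card, Nat.card_eq_fintype_card, this, mul_comm]

end OrientedGluing

/-- A fixed point free involution has a set of representatives, of half the cardinality. -/
theorem Function.Involutive.exists_representatives {X : Type*} [Finite X] {f : X → X}
    (hf : f.Involutive) (hne : ∀ x, f x ≠ x) :
    ∃ S : Set X, 2 * Nat.card S = Nat.card X ∧ ∀ x, x ∈ S ∨ f x ∈ S := by
  classical
  obtain ⟨n, ⟨e⟩⟩ := Finite.exists_equiv_fin X
  have hcompl : {x | e x < e (f x)}ᶜ = f '' {x | e x < e (f x)} := by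
    ext x
    simp only [Set.mem_compl_iff, Set.mem_ofPred_eq, hf.image_eq_preimage_symm,
      Set.mem_preimage, hf x, not_lt]
    exact ⟨fun h ↦ lt_of_le_of_ne h fun h' ↦ hne x (e.injective h'), le_of_lt⟩
  refine ⟨{x | e x < e (f x)}, ?_, fun x ↦ ?_⟩
  · have h1 := Set.ncard_add_ncard_compl {x | e x < e (f x)}
    rw [hcompl, Set.ncard_image_of_injective _ hf.injective] at h1
    rw [Nat.card_coe_set_eq]
    omega
  · by_cases h : x ∈ {x | e x < e (f x)}
    · exact .inl h
    · right
      rw [← Set.mem_compl_iff, hcompl] at h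
      obtain ⟨y, hy, rfl⟩ := h
      rwa [hf y]

namespace OrientedGluing

variable {T : Type*} (G : OrientedGluing T)

/-- Each edge carries at most two directed edges. (Exactly two, in fact, but only this inequality is
needed.) -/
theorem card_linkVertex_le [Finite T] : Nat.card G.LinkVertex ≤ 2 * Nat.card G.Edge := by
  classical
  let s (p : T × SimplexEdge) : Set G.LinkVertex :=
    {x | ∃ (v j : Fin 4) (h : v ≠ j), p.2.1 = {v, j} ∧ x = Quot.mk _ (p.1, ⟨(v, j), h⟩)}
  have hs : ∀ p q, G.EdgeRel p q → s p = s q := by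
    rintro ⟨t, f, hf⟩ ⟨t', f', hf'⟩ ⟨i, hi, rfl, rfl⟩
    ext x
    constructor
    · rintro ⟨v, j, h, rfl, rfl⟩
      refine ⟨G.glue t i v, G.glue t i j, (G.glue t i).injective.ne h, by simp,
        Quot.sound ⟨i, ?_, ?_, rfl, rfl, rfl⟩⟩
      · rintro rfl; simp at hi
      · rintro rfl; simp at hi
    · rintro ⟨v, j, h, h', rfl⟩
      have h'' : f = {(G.glue t i).symm v, (G.glue t i).symm j} := by
        have := congrArg (Finset.map (G.glue t i).symm.toEmbedding) h'
        simpa [Finset.map_map] using this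
      have hi' : i ∉ f := hi
      rw [h'', Finset.mem_insert, Finset.mem_singleton, not_or] at hi'
      subst h''
      refine ⟨_, _, (G.glue t i).symm.injective.ne h, rfl,
        (Quot.sound ⟨i, ?_, ?_, rfl, by simp, by simp⟩).symm⟩
      · exact Ne.symm hi'.1
      · exact Ne.symm hi'.2
  have hcard (p) : (s p).ncard ≤ 2 := by
    obtain ⟨t, f, hf⟩ := p
    obtain ⟨v, j, h, rfl⟩ := Finset.card_eq_two.1 hf
    refine (Set.ncard_le_ncard (t := {Quot.mk _ (t, ⟨(v, j), h⟩), Quot.mk _ (t, ⟨(j, v), h.symm⟩)})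
      ?_).trans ((Set.ncard_insert_le _ _).trans (by simp))
    rintro _ ⟨v', j', h', hf', rfl⟩
    have : (v' = v ∧ j' = j) ∨ (v' = j ∧ j' = v) := by
      have h1 : v' ∈ ({v, j} : Finset (Fin 4)) := by simp only at hf'; rw [hf']; simp
      have h2 : j' ∈ ({v, j} : Finset (Fin 4)) := by simp only at hf'; rw [hf']; simp
      grind
    rcases this with ⟨rfl, rfl⟩ | ⟨rfl, rfl⟩ <;> simp
  let S : G.Edge → Set G.LinkVertex := Quot.lift s hs
  have hS (e) : (S e).ncard ≤ 2 := Quot.ind (β := fun e ↦ (S e).ncard ≤ 2) hcard e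
  have : Fintype G.Edge := Fintype.ofFinite _
  have hunion : (⋃ e, S e) = Set.univ := by
    refine Set.eq_univ_of_forall fun x ↦ Set.mem_iUnion.2 ?_
    induction x using Quot.ind with
    | mk p =>
      obtain ⟨t, ⟨v, j⟩, h⟩ := p
      exact ⟨Quot.mk _ (t, ⟨{v, j}, Finset.card_pair h⟩), v, j, h, rfl, rfl⟩
  calc Nat.card G.LinkVertex = (⋃ e, S e).ncard := by rw [hunion, Set.ncard_univ]
    _ ≤ ∑ e, (S e).ncard := by
      simpa using Set.ncard_iUnion_le_of_fintype S
    _ ≤ ∑ _e : G.Edge, 2 := Finset.sum_le_sum fun e _ ↦ hS e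
    _ = 2 * Nat.card G.Edge := by simp [Nat.card_eq_fintype_card, mul_comm]

/-- The Euler characteristic of the vertex links is positive if their first cohomology vanishes:
with rational coefficients, the cocycles form a space of dimension at least the number of edges
minus the number of triangles, and the coboundaries form one of dimension less than the number of
vertices. Here both spaces are enlarged by the constants on the triangles. -/
theorem two_mul_card_lt_card_linkVertex [Fintype T] [Nonempty T]
    (H : ∀ h : T → Fin 4 → Fin 4 → ℤ, G.IsLinkCocycle h → G.IsLinkCoboundary h) :
    2 * Fintype.card T < Nat.card G.LinkVertex := by
  classical
  have : Fintype G.LinkVertex := Fintype.ofFinite _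
  have hsel : ∀ x : {p : Fin 4 × Fin 4 // p.1 ≠ p.2}, ∃ a b : Fin 4,
      x.1.1 ≠ a ∧ x.1.1 ≠ b ∧ a ≠ x.1.2 ∧ b ≠ x.1.2 ∧ a ≠ b := by decide
  choose a b ha hb ha' hb' hab using hsel
  obtain ⟨S, hScard, hS⟩ :=
    G.linkEdgeInv_involutive.exists_representatives G.linkEdgeInv_ne
  let img (x : DirectedEdge T) (j : Fin 4) (h : x.2.1.1 ≠ j) : DirectedEdge T :=
    (G.adj x.1 x.2.1.2, ⟨(G.glue x.1 x.2.1.2 x.2.1.1, G.glue x.1 x.2.1.2 j),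
      (G.glue x.1 x.2.1.2).injective.ne h⟩)
  -- One equation for each pair of identified edges of the normal triangles.
  let Φ : (DirectedEdge T → ℚ) →ₗ[ℚ] (S → ℚ) :=
    { toFun h x := h (x.1.1, ⟨(x.1.2.1.1, a x.1.2), ha x.1.2⟩) -
        h (x.1.1, ⟨(x.1.2.1.1, b x.1.2), hb x.1.2⟩) -
        (h (img x (a x.1.2) (ha _)) - h (img x (b x.1.2) (hb _)))
      map_add' h h' := by ext x; simp only [Pi.add_apply]; ring
      map_smul' c h := by ext x; simp only [Pi.smul_apply, smul_eq_mul, RingHom.id_apply]; ring }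
  let Ψ : ((G.LinkVertex → ℚ) × (T × Fin 4 → ℚ)) →ₗ[ℚ] (DirectedEdge T → ℚ) :=
    { toFun p x := p.1 (Quot.mk _ x) - p.2 (x.1, x.2.1.1)
      map_add' p q := by ext x; simp only [Prod.fst_add, Prod.snd_add, Pi.add_apply]; ring
      map_smul' c p := by
        ext x; simp only [Prod.smul_fst, Prod.smul_snd, Pi.smul_apply, smul_eq_mul,
          RingHom.id_apply]; ring }
  have hcocycle (h : T → Fin 4 → Fin 4 → ℤ) (hh : ∀ x ∈ S,
      h x.1 x.2.1.1 (a x.2) - h x.1 x.2.1.1 (b x.2) =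
        h (G.adj x.1 x.2.1.2) (G.glue x.1 x.2.1.2 x.2.1.1) (G.glue x.1 x.2.1.2 (a x.2)) -
        h (G.adj x.1 x.2.1.2) (G.glue x.1 x.2.1.2 x.2.1.1) (G.glue x.1 x.2.1.2 (b x.2))) :
      G.IsLinkCocycle h := by
    have key : ∀ x ∈ S, ∀ j k, j ≠ x.2.1.1 → j ≠ x.2.1.2 → k ≠ x.2.1.1 → k ≠ x.2.1.2 →
        h x.1 x.2.1.1 j - h x.1 x.2.1.1 k =
        h (G.adj x.1 x.2.1.2) (G.glue x.1 x.2.1.2 x.2.1.1) (G.glue x.1 x.2.1.2 j) -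
        h (G.adj x.1 x.2.1.2) (G.glue x.1 x.2.1.2 x.2.1.1) (G.glue x.1 x.2.1.2 k) := by
      intro x hx j k hj hj' hk hk'
      have h0 := hh x hx
      have h1 := x.2.2
      have h2 := ha x.2
      have h3 := hb x.2
      have h4 := ha' x.2
      have h5 := hb' x.2
      have h6 := hab x.2
      have h7 : j = a x.2 ∨ j = b x.2 := by clear h0 hh; omega
      have h8 : k = a x.2 ∨ k = b x.2 := by clear h0 hh h7; omega
      rcases h7 with rfl | rfl <;> rcases h8 with rfl | rfl <;> linarith
    intro t i v j k hv hj hj' hk hk'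
    rcases hS (t, ⟨(v, i), hv⟩) with hx | hx
    · exact key _ hx j k hj hj' hk hk'
    · have := key _ hx (G.glue t i j) (G.glue t i k)
        ((G.glue t i).injective.ne hj) ((G.glue t i).injective.ne hj')
        ((G.glue t i).injective.ne hk) ((G.glue t i).injective.ne hk')
      simp only [linkEdgeInv, G.adj_adj, G.glue_glue, Equiv.Perm.inv_def,
        Equiv.symm_apply_apply] at this
      exact this.symm
  have hle : LinearMap.ker Φ ≤ LinearMap.range Ψ := by
    intro h hh
    obtain ⟨m, hm⟩ := IsLocalization.exist_integer_multiples_of_finite (nonZeroDivisors ℤ) h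
    choose h' hh' using hm
    have hm0 : ((m : ℤ) : ℚ) ≠ 0 := by exact_mod_cast nonZeroDivisors.coe_ne_zero m
    have hh'' (x) : (h' x : ℚ) = (m : ℤ) * h x := by simpa using hh' x
    let H' (t : T) (v j : Fin 4) : ℤ := if hv : v ≠ j then h' (t, ⟨(v, j), hv⟩) else 0
    have hH' (x : DirectedEdge T) : H' x.1 x.2.1.1 x.2.1.2 = h' x := dif_pos x.2.2
    obtain ⟨k, hk⟩ := H H' (hcocycle H' fun x hx ↦ by
      have h1 := congr_fun (LinearMap.mem_ker.1 hh) ⟨x, hx⟩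
      have h2 := hH' (x.1, ⟨(x.2.1.1, a x.2), ha x.2⟩)
      have h3 := hH' (x.1, ⟨(x.2.1.1, b x.2), hb x.2⟩)
      have h4 := hH' (img x (a x.2) (ha _))
      have h5 := hH' (img x (b x.2) (hb _))
      dsimp only [img] at h2 h3 h4 h5
      rw [h2, h3, h4, h5]
      simp only [Φ, LinearMap.coe_mk, AddHom.coe_mk, Pi.zero_apply] at h1
      have h6 : ((m : ℤ) : ℚ) * 0 = 0 := mul_zero _
      rw [← h1] at h6
      have : ((h' (x.1, ⟨(x.2.1.1, a x.2), ha x.2⟩) - h' (x.1, ⟨(x.2.1.1, b x.2), hb x.2⟩) : ℤ) : ℚ)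
          = ((h' (img x (a x.2) (ha _)) - h' (img x (b x.2) (hb _)) : ℤ) : ℚ) := by
        push_cast
        rw [hh'', hh'', hh'', hh'']
        linarith
      exact_mod_cast this)
    refine ⟨(Quot.lift (fun x ↦ ((h' x + k x.1 x.2.1.1 : ℤ) : ℚ) / (m : ℤ)) ?_,
      fun p ↦ (k p.1 p.2 : ℚ) / (m : ℤ)), ?_⟩
    · rintro x y ⟨i, h1, h2, h3, h4, h5⟩
      have := hk x.1 i x.2.1.1 x.2.1.2 h1 x.2.2.symm h2
      rw [← h3, ← h4, ← h5, hH', hH'] at this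
      simp only [this]
    · ext x
      simp only [Ψ, LinearMap.coe_mk, AddHom.coe_mk]
      push_cast
      rw [hh'']
      field_simp
      ring
  have hΦ := Φ.finrank_range_add_finrank_ker
  have hΦ' := (LinearMap.range Φ).finrank_le
  have hΨ := Ψ.finrank_range_add_finrank_ker
  have hle' := Submodule.finrank_mono hle
  -- The constant functions on a link come from its vertices as well as from its triangles.
  have hker : 0 < Module.finrank ℚ (LinearMap.ker Ψ) := by
    have hmem : ((fun _ ↦ 1, fun _ ↦ 1) : (G.LinkVertex → ℚ) × (T × Fin 4 → ℚ)) ∈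
        LinearMap.ker Ψ := by
      rw [LinearMap.mem_ker]; ext x; simp [Ψ]
    have : Nontrivial (LinearMap.ker Ψ) := ⟨⟨_, hmem⟩, 0, fun h ↦ by
      obtain ⟨t⟩ := ‹Nonempty T›
      simpa using congr_fun (congrArg Prod.snd (congrArg Subtype.val h)) (t, 0)⟩
    exact Module.finrank_pos
  have hcardN := card_directedEdge (T := T)
  simp only [Nat.card_eq_fintype_card] at hScard hcardN
  simp only [Module.finrank_prod, Module.finrank_fintype_fun_eq_card] at hΦ hΦ' hΨ
  have h4 : Fintype.card (T × Fin 4) = 4 * Fintype.card T := by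
    rw [Fintype.card_prod, Fintype.card_fin, mul_comm]
  rw [Nat.card_eq_fintype_card]
  omega

/-- In dimension three, the number of edges exceeds the number of tetrahedra if the first cohomology
of the vertex links vanishes. -/
theorem card_lt_card_edge [Fintype T] [Nonempty T]
    (H : ∀ h : T → Fin 4 → Fin 4 → ℤ, G.IsLinkCocycle h → G.IsLinkCoboundary h) :
    Fintype.card T < Nat.card G.Edge := by
  have h1 := G.two_mul_card_lt_card_linkVertex H
  have h2 := G.card_linkVertex_le
  omega

end OrientedGluing

namespace OrientedGluing

variable {T : Type*} (G : OrientedGluing T)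

/-! ### Cohomology of the vertex links of a manifold -/

/-- The image in the realization of the vertex `v` of `t`. -/
def vertexPoint (t : T) (v : Fin 4) : G.Realization :=
  Quot.mk _ ⟨t, Pi.single v 1, single_mem_stdSimplex ℝ v⟩

theorem vertexPoint_glue (t : T) {i v : Fin 4} (h : v ≠ i) :
    G.vertexPoint (G.adj t i) (G.glue t i v) = G.vertexPoint t v :=
  (Quot.sound ⟨i, by simp [h.symm], rfl, fun j ↦ by simp [Pi.single_apply]⟩).symm

/-- The point on the edge `vj` with barycentric coordinates `1 - ε` at `v` and `ε` at `j`. -/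
def edgePoint (v j : Fin 4) {ε : ℝ} (hε : ε ∈ Set.Icc (0 : ℝ) 1) : stdSimplex ℝ (Fin 4) :=
  ⟨(1 - ε) • Pi.single v 1 + ε • Pi.single j 1,
    convex_stdSimplex ℝ (Fin 4) (single_mem_stdSimplex ℝ v) (single_mem_stdSimplex ℝ j)
      (sub_nonneg.2 hε.2) hε.1 (by ring)⟩

theorem mk_edgePoint_glue (t : T) {i v j : Fin 4} (hv : v ≠ i) (hj : j ≠ i) {ε : ℝ}
    (hε : ε ∈ Set.Icc (0 : ℝ) 1) :
    (Quot.mk _ ⟨G.adj t i, edgePoint (G.glue t i v) (G.glue t i j) hε⟩ : G.Realization) =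
      Quot.mk _ ⟨t, edgePoint v j hε⟩ :=
  (Quot.sound ⟨i, by simp [edgePoint, hv.symm, hj.symm], rfl,
    fun l ↦ by simp [edgePoint, Pi.single_apply]⟩).symm

/-- The function on the complement of the vertex `v` that is affine on each triangle parallel to the
face `v`, and has the value `h j` on the edge `vj`. -/
noncomputable def coneExtension (h : Fin 4 → ℤ) (v : Fin 4) (x : Fin 4 → ℝ) : ℝ :=
  (∑ j ∈ Finset.univ.erase v, x j * h j) / (1 - x v)

theorem continuousAt_coneExtension (h : Fin 4 → ℤ) {v : Fin 4} {x : Fin 4 → ℝ} (hx : x v ≠ 1) :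
    ContinuousAt (coneExtension h v) x :=
  ContinuousAt.div
    (Continuous.continuousAt <| continuous_finsetSum _ fun j _ ↦
      (continuous_apply j).mul continuous_const)
    (continuous_const.sub (continuous_apply v)).continuousAt (sub_ne_zero.2 hx.symm)

theorem coneExtension_edgePoint (h : Fin 4 → ℤ) {v j : Fin 4} (hj : j ≠ v) {ε : ℝ}
    (hε : ε ∈ Set.Icc (0 : ℝ) 1) (hε0 : ε ≠ 0) :
    coneExtension h v (edgePoint v j hε).1 = h j := by
  have : ∑ l ∈ Finset.univ.erase v, (edgePoint v j hε).1 l * h l = ε * h j := by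
    rw [Finset.sum_eq_single_of_mem j (by simp [hj])]
    · simp [edgePoint, hj]
    · intro l hl hlj
      simp [edgePoint, hlj, Finset.ne_of_mem_erase hl]
  rw [coneExtension, this]
  simp [edgePoint, hj.symm, hε0]

theorem coneExtension_glue {h : T → Fin 4 → Fin 4 → ℤ} (hh : G.IsLinkCocycle h) {t : T}
    {i v : Fin 4} (hv : v ≠ i) {x y : Fin 4 → ℝ} (hx : ∑ j, x j = 1) (hi : x i = 0)
    (hxy : ∀ j, y (G.glue t i j) = x j) :
    (coneExtension (h (G.adj t i) (G.glue t i v)) (G.glue t i v) y : AddCircle (1 : ℝ)) =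
      coneExtension (h t v) v x := by
  rcases eq_or_ne (x v) 1 with hv1 | hv1
  -- At the vertex itself, both sides are quotients by zero.
  · simp [coneExtension, hxy, hv1]
  obtain ⟨j₀, hj₀, hj₀'⟩ : ∃ j, j ≠ v ∧ j ≠ i :=
    (by decide : ∀ v i : Fin 4, ∃ j, j ≠ v ∧ j ≠ i) v i
  have h1 : ∑ j ∈ Finset.univ.erase (G.glue t i v), y j * h (G.adj t i) (G.glue t i v) j =
      ∑ j ∈ Finset.univ.erase v, x j * h (G.adj t i) (G.glue t i v) (G.glue t i j) := by
    refine (Finset.sum_equiv (G.glue t i) (by simp) fun j _ ↦ by rw [hxy]).symm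
  have h2 : ∑ j ∈ Finset.univ.erase v, x j = 1 - x v := by
    rw [← hx, ← Finset.add_sum_erase _ _ (Finset.mem_univ v)]; ring
  have h3 : ∑ j ∈ Finset.univ.erase v, x j * h t v j -
      ∑ j ∈ Finset.univ.erase v, x j * h (G.adj t i) (G.glue t i v) (G.glue t i j) =
      (1 - x v) * (h t v j₀ - h (G.adj t i) (G.glue t i v) (G.glue t i j₀)) := by
    rw [← h2, Finset.sum_mul, ← Finset.sum_sub_distrib]
    refine Finset.sum_congr rfl fun j hj ↦ ?_
    rcases eq_or_ne j i with rfl | hji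
    · simp [hi]
    · have := hh t i v j j₀ hv (Finset.ne_of_mem_erase hj) hji hj₀ hj₀'
      rw [← mul_sub]
      congr 1
      have h4 : h t v j - h (G.adj t i) (G.glue t i v) (G.glue t i j) =
        h t v j₀ - h (G.adj t i) (G.glue t i v) (G.glue t i j₀) := by linarith
      exact_mod_cast h4
  symm
  rw [← sub_eq_zero, ← AddCircle.coe_sub, AddCircle.coe_eq_zero_iff]
  refine ⟨h t v j₀ - h (G.adj t i) (G.glue t i v) (G.glue t i j₀), ?_⟩
  rw [coneExtension, coneExtension, h1, hxy, ← sub_div, h3,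
    mul_div_cancel_left₀ _ (sub_ne_zero.2 hv1.symm)]
  simp

/-- The circle-valued function on the realization which near each vertex `v` of each tetrahedron `t`
is the reduction of `coneExtension (h t v) v`. It vanishes where no barycentric coordinate exceeds
`1 / 2`. -/
noncomputable def circleMap {h : T → Fin 4 → Fin 4 → ℤ} (hh : G.IsLinkCocycle h) :
    G.Realization → AddCircle (1 : ℝ) :=
  Quot.lift (fun p ↦ ∑ v, if 1 / 2 < p.2.1 v then
      (coneExtension (h p.1 v) v p.2.1 : AddCircle (1 : ℝ)) else 0) <| by
    rintro ⟨t, x, hx⟩ ⟨_, y, hy⟩ ⟨i, hi, rfl, hxy⟩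
    dsimp only at hi hxy ⊢
    rw [← Equiv.sum_comp (G.glue t i) fun v ↦ if 1 / 2 < y v then
      (coneExtension (h (G.adj t i) v) v y : AddCircle (1 : ℝ)) else 0]
    refine Finset.sum_congr rfl fun v _ ↦ ?_
    rw [hxy]
    refine if_ctx_congr Iff.rfl (fun hv ↦ ?_) fun _ ↦ rfl
    refine (G.coneExtension_glue hh ?_ hx.2 hi hxy).symm
    rintro rfl
    norm_num [hi] at hv

theorem add_le_one_of_ne (x : stdSimplex ℝ (Fin 4)) {v w : Fin 4} (hw : w ≠ v) :
    x.1 w + x.1 v ≤ 1 := by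
  rw [← Finset.sum_pair hw, ← x.2.2]
  exact Finset.sum_le_sum_of_subset_of_nonneg (Finset.subset_univ _) fun j _ _ ↦ x.2.1 j

/-- At most one barycentric coordinate exceeds `1 / 2`. -/
theorem lt_half_of_half_lt (x : stdSimplex ℝ (Fin 4)) {v w : Fin 4} (hw : w ≠ v)
    (hv : 1 / 2 < x.1 v) : x.1 w < 1 / 2 := by
  linarith [add_le_one_of_ne x hw]

theorem circleMap_mk {h : T → Fin 4 → Fin 4 → ℤ} (hh : G.IsLinkCocycle h) (t : T)
    {x : stdSimplex ℝ (Fin 4)} {v : Fin 4} (hv : 1 / 2 < x.1 v) :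
    G.circleMap hh (Quot.mk _ ⟨t, x⟩) = coneExtension (h t v) v x.1 := by
  refine (Finset.sum_eq_single_of_mem v (Finset.mem_univ v) fun w _ hw ↦ ?_).trans (if_pos hv)
  exact if_neg (lt_half_of_half_lt x hw hv).not_gt

/-- The points of the realization which have, in some tetrahedron, a barycentric coordinate in `I`
with respect to a vertex that represents a point of `P`. -/
def starRegion (P : Set G.Realization) {I : Set ℝ} (hI : 0 ∉ I) : Set G.Realization :=
  {r | Quot.lift (fun p : Σ _ : T, stdSimplex ℝ (Fin 4) ↦
    ∃ v, p.2.1 v ∈ I ∧ G.vertexPoint p.1 v ∈ P) (by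
      rintro ⟨t, x, hx⟩ ⟨_, y, hy⟩ ⟨i, hi, rfl, hxy⟩
      dsimp only at hi hxy ⊢
      have hne {v : Fin 4} (hv : x v ∈ I) : v ≠ i := by
        rintro rfl
        exact hI (hi ▸ hv)
      apply propext
      constructor
      · rintro ⟨v, hv, hvP⟩
        exact ⟨G.glue t i v, by rwa [hxy], by rwa [G.vertexPoint_glue t (hne hv)]⟩
      · rintro ⟨w, hw, hwP⟩
        obtain ⟨v, rfl⟩ := (G.glue t i).surjective w
        rw [hxy] at hw
        exact ⟨v, hw, by rwa [G.vertexPoint_glue t (hne hw)] at hwP⟩) r}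

theorem mk_mem_starRegion {P : Set G.Realization} {I : Set ℝ} (hI : 0 ∉ I) (t : T)
    (x : stdSimplex ℝ (Fin 4)) :
    (Quot.mk _ ⟨t, x⟩ : G.Realization) ∈ G.starRegion P hI ↔
      ∃ v, x.1 v ∈ I ∧ G.vertexPoint t v ∈ P := Iff.rfl

theorem isOpen_starRegion (P : Set G.Realization) {I : Set ℝ} (hI : 0 ∉ I) (hIo : IsOpen I) :
    IsOpen (G.starRegion P hI) := by
  rw [← isQuotientMap_quot_mk.isOpen_preimage, isOpen_sigma_iff]
  intro t
  have : (Sigma.mk t ⁻¹' (Quot.mk G.PointRel ⁻¹' G.starRegion P hI)) =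
      ⋃ v, ⋃ _ : G.vertexPoint t v ∈ P, {x : stdSimplex ℝ (Fin 4) | x.1 v ∈ I} := by
    ext x
    simp only [Set.mem_preimage, mk_mem_starRegion, Set.mem_iUnion, exists_prop]
    exact exists_congr fun _ ↦ and_comm
  rw [this]
  exact isOpen_iUnion fun v ↦ isOpen_iUnion fun _ ↦
    hIo.preimage ((continuous_apply v).comp continuous_subtype_val)

/-- The points of the realization close to a vertex, but different from it. -/
def puncturedStars : Set G.Realization :=
  G.starRegion Set.univ (I := Set.Ioo (1 / 2) 1) (by norm_num)

theorem mk_mem_puncturedStars {t : T} {x : stdSimplex ℝ (Fin 4)} :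
    (Quot.mk _ ⟨t, x⟩ : G.Realization) ∈ G.puncturedStars ↔ ∃ v, 1 / 2 < x.1 v ∧ x.1 v < 1 := by
  simp [puncturedStars, mk_mem_starRegion]

theorem vertexPoint_notMem_puncturedStars (t : T) (v : Fin 4) :
    G.vertexPoint t v ∉ G.puncturedStars := by
  rw [vertexPoint, mk_mem_puncturedStars]
  rintro ⟨w, hw, hw'⟩
  rcases eq_or_ne w v with rfl | h
  · simp at hw'
  · norm_num [h] at hw

theorem continuousOn_circleMap {h : T → Fin 4 → Fin 4 → ℤ} (hh : G.IsLinkCocycle h) :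
    ContinuousOn (G.circleMap hh) G.puncturedStars := by
  have ho : IsOpen G.puncturedStars := G.isOpen_starRegion _ _ isOpen_Ioo
  rw [isQuotientMap_quot_mk.continuousOn_isOpen_iff ho]
  rintro ⟨t, x⟩ hx
  obtain ⟨v, hv, hv'⟩ := G.mk_mem_puncturedStars.1 hx
  refine ContinuousAt.continuousWithinAt ?_
  rw [ContinuousAt, Sigma.nhds_mk, Filter.tendsto_map'_iff]
  have hc : ContinuousAt (fun y : stdSimplex ℝ (Fin 4) ↦
      (coneExtension (h t v) v y.1 : AddCircle (1 : ℝ))) x :=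
    (AddCircle.continuous_mk' 1).continuousAt.comp
      ((continuousAt_coneExtension (h t v) hv'.ne).comp continuous_subtype_val.continuousAt)
  have hU : ∀ᶠ y : stdSimplex ℝ (Fin 4) in nhds x, 1 / 2 < y.1 v :=
    ((continuous_apply v).comp continuous_subtype_val).continuousAt.eventually_const_lt hv
  exact hc.congr (hU.mono fun y hy ↦ (G.circleMap_mk hh t hy).symm)

/-- Near a vertex, the vertex excepted, the circle-valued map lifts to the real line, because a
punctured neighbourhood of a point of a 3-manifold can be taken to be a punctured ball. -/
theorem exists_lift_circleMap {M : Type*} [TopologicalSpace M]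
    [ChartedSpace (EuclideanSpace ℝ (Fin 3)) M] (e : G.Realization ≃ₜ M)
    {h : T → Fin 4 → Fin 4 → ℤ} (hh : G.IsLinkCocycle h) (t₀ : T) (v₀ : Fin 4) :
    ∃ W : Set G.Realization, IsOpen W ∧ G.vertexPoint t₀ v₀ ∈ W ∧ ∃ F : G.Realization → ℝ,
      ContinuousOn F (W ∩ G.puncturedStars) ∧
      ∀ r ∈ W ∩ G.puncturedStars, (F r : AddCircle (1 : ℝ)) = G.circleMap hh r := by
  set P := G.vertexPoint t₀ v₀ with hP
  let ψ : OpenPartialHomeomorph G.Realization (EuclideanSpace ℝ (Fin 3)) :=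
    e.toOpenPartialHomeomorph.trans (chartAt _ (e P))
  have hPψ : P ∈ ψ.source := by simp [ψ]
  let U : Set G.Realization := G.starRegion {P} (I := Set.Ioi (1 / 2)) (by norm_num)
  have hUo : IsOpen U := G.isOpen_starRegion _ _ isOpen_Ioi
  have hPU : P ∈ U := (G.mk_mem_starRegion _ _ _).2 ⟨v₀, by norm_num, hP.symm⟩
  have hU : ∀ r ∈ U, r ≠ P → r ∈ G.puncturedStars := by
    intro r hr hrP
    induction r using Quot.ind with
    | mk p =>
      obtain ⟨t, x⟩ := p
      obtain ⟨v, hv, hvP⟩ := (G.mk_mem_starRegion _ _ _).1 hr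
      refine G.mk_mem_puncturedStars.2 ⟨v, hv, lt_of_le_of_ne
        (mem_Icc_of_mem_stdSimplex x.2 v).2 fun h1 ↦ hrP ?_⟩
      rw [← Set.mem_singleton_iff.1 hvP, vertexPoint]
      congr
      refine Subtype.ext (funext fun j ↦ ?_)
      rcases eq_or_ne j v with rfl | hj
      · simpa using h1
      · have h2 := add_le_one_of_ne x hj
        simpa [hj] using le_antisymm (by linarith) (x.2.1 j)
  obtain ⟨r, hr, hball⟩ := Metric.isOpen_iff.1 (ψ.isOpen_inter_preimage_symm hUo) (ψ P)
    ⟨ψ.map_source hPψ, by rwa [Set.mem_preimage, ψ.left_inv hPψ]⟩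
  have hmaps : Set.MapsTo ψ.symm (Metric.ball (ψ P) r \ {ψ P}) G.puncturedStars :=
    fun y hy ↦ hU _ (hball hy.1).2 fun h ↦ hy.2 (by
      rw [Set.mem_singleton_iff, ← h, ψ.right_inv (hball hy.1).1])
  obtain ⟨F, hFc, hF⟩ := exists_circle_lift_puncturedBall (by simp) hr
    (f := G.circleMap hh ∘ ψ.symm) ((G.continuousOn_circleMap hh).comp
      (ψ.symm.continuousOn.mono fun y hy ↦ (hball hy.1).1) hmaps)
  have hmaps' : Set.MapsTo ψ ((ψ.source ∩ ψ ⁻¹' Metric.ball (ψ P) r) ∩ G.puncturedStars)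
      (Metric.ball (ψ P) r \ {ψ P}) := fun s hs ↦ ⟨hs.1.2, fun h ↦
    G.vertexPoint_notMem_puncturedStars t₀ v₀ (by
      rw [← hP, ← ψ.injOn hs.1.1 hPψ h]
      exact hs.2)⟩
  refine ⟨ψ.source ∩ ψ ⁻¹' Metric.ball (ψ P) r, ψ.isOpen_inter_preimage Metric.isOpen_ball,
    ⟨hPψ, Metric.mem_ball_self hr⟩, F ∘ ψ,
    hFc.comp (ψ.continuousOn.mono fun s hs ↦ hs.1.1) hmaps', fun s hs ↦ ?_⟩
  rw [Function.comp_apply, hF _ (hmaps' hs), Function.comp_apply, ψ.left_inv hs.1.1]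

/-- A neighbourhood of a vertex of the triangulation contains a copy of its link, made of triangles
at the same height `1 - ε` in all tetrahedra. -/
theorem exists_truncation_subset [Finite T] {W : Set G.Realization} (hW : IsOpen W)
    {P : G.Realization} (hP : P ∈ W) :
    ∃ ε : ℝ, 0 < ε ∧ ε < 1 / 2 ∧ ∀ t v, G.vertexPoint t v = P →
      ∀ x : stdSimplex ℝ (Fin 4), x.1 v = 1 - ε → (Quot.mk _ ⟨t, x⟩ : G.Realization) ∈ W := by
  have key : ∀ t v, ∀ᶠ ε : ℝ in nhdsWithin 0 (Set.Ioi 0), G.vertexPoint t v = P →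
      ∀ x : stdSimplex ℝ (Fin 4), x.1 v = 1 - ε → (Quot.mk _ ⟨t, x⟩ : G.Realization) ∈ W := by
    intro t v
    by_cases hv : G.vertexPoint t v = P
    swap
    · exact .of_forall fun _ h ↦ absurd h hv
    have hopen : IsOpen {x : stdSimplex ℝ (Fin 4) | (Quot.mk _ ⟨t, x⟩ : G.Realization) ∈ W} :=
      hW.preimage (continuous_quot_mk.comp continuous_sigmaMk)
    obtain ⟨δ, hδ, hball⟩ := Metric.isOpen_iff.1 hopen
      ⟨Pi.single v 1, single_mem_stdSimplex ℝ v⟩ (show G.vertexPoint t v ∈ W from hv ▸ hP)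
    filter_upwards [Ioo_mem_nhdsGT hδ] with ε hε _ x hx
    refine hball (lt_of_le_of_lt ?_ hε.2)
    rw [Subtype.dist_eq, dist_pi_le_iff hε.1.le]
    intro j
    rw [Real.dist_eq]
    rcases eq_or_ne j v with rfl | hj
    · simp [hx, abs_of_pos hε.1]
    · have h2 := add_le_one_of_ne x hj
      simp only [ne_eq, hj, not_false_eq_true, Pi.single_eq_of_ne, sub_zero]
      rw [abs_of_nonneg (x.2.1 j)]
      linarith
  obtain ⟨ε, hε, hε'⟩ := ((Filter.eventually_all.2 fun t ↦ Filter.eventually_all.2 (key t)).and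
    (Ioo_mem_nhdsGT (show (0 : ℝ) < 1 / 2 by norm_num))).exists
  exact ⟨ε, hε'.1, hε'.2, hε⟩

theorem isPreconnected_slice (v : Fin 4) (a : ℝ) :
    IsPreconnected {x : stdSimplex ℝ (Fin 4) | x.1 v = a} := by
  rw [← Topology.IsInducing.subtypeVal.isPreconnected_image]
  have : Subtype.val '' {x : stdSimplex ℝ (Fin 4) | x.1 v = a} =
      stdSimplex ℝ (Fin 4) ∩ {x | x v = a} := by
    ext x; simp [and_comm]
  rw [this]
  exact ((convex_stdSimplex ℝ (Fin 4)).inter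
    (convex_hyperplane (LinearMap.proj (R := ℝ) v).isLinear a)).isPreconnected

/-- The first cohomology of the vertex links of a triangulated 3-manifold vanishes. A lift of
`circleMap` to the real line differs from the affine function defined by `h` by an integer on each
triangle of a small link; and its values at the vertices of the link are intrinsic. -/
theorem IsLinkCocycle.isLinkCoboundary {G : OrientedGluing T} [Finite T] {M : Type*}
    [TopologicalSpace M] [ChartedSpace (EuclideanSpace ℝ (Fin 3)) M] (e : G.Realization ≃ₜ M)
    {h : T → Fin 4 → Fin 4 → ℤ} (hh : G.IsLinkCocycle h) : G.IsLinkCoboundary h := by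
  have key : ∀ P : G.Realization, ∃ k : T → Fin 4 → ℤ, ∀ t i v j, G.vertexPoint t v = P →
      v ≠ i → j ≠ v → j ≠ i →
      h t v j + k t v = h (G.adj t i) (G.glue t i v) (G.glue t i j) +
        k (G.adj t i) (G.glue t i v) := by
    intro P
    by_cases hP : ∃ t v, G.vertexPoint t v = P
    swap
    · exact ⟨0, fun t i v j hv ↦ absurd ⟨t, v, hv⟩ hP⟩
    obtain ⟨t₀, v₀, rfl⟩ := hP
    obtain ⟨W, hWo, hPW, F, hFc, hF⟩ := G.exists_lift_circleMap e hh t₀ v₀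
    obtain ⟨ε, hε, hε', hW⟩ := G.exists_truncation_subset hWo hPW
    have hεI : ε ∈ Set.Icc (0 : ℝ) 1 := ⟨hε.le, by linarith⟩
    have hslice (t : T) (v : Fin 4) : ∃ n : ℤ, G.vertexPoint t v = G.vertexPoint t₀ v₀ →
        ∀ x : stdSimplex ℝ (Fin 4), x.1 v = 1 - ε →
          F (Quot.mk _ ⟨t, x⟩) - coneExtension (h t v) v x.1 = n := by
      by_cases hv : G.vertexPoint t v = G.vertexPoint t₀ v₀
      swap
      · exact ⟨0, fun h ↦ absurd h hv⟩
      have hmem : Set.MapsTo (fun x : stdSimplex ℝ (Fin 4) ↦ (Quot.mk _ ⟨t, x⟩ : G.Realization))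
          {x | x.1 v = 1 - ε} (W ∩ G.puncturedStars) := by
        intro x (hx : x.1 v = 1 - ε)
        exact ⟨hW t v hv x hx, G.mk_mem_puncturedStars.2 ⟨v, by linarith, by linarith⟩⟩
      obtain ⟨n, hn⟩ := (isPreconnected_slice v (1 - ε)).exists_int_eq
        (F := fun x ↦ F (Quot.mk _ ⟨t, x⟩) - coneExtension (h t v) v x.1)
        ((hFc.comp (continuous_quot_mk.comp continuous_sigmaMk).continuousOn hmem).sub
          fun x (hx : x.1 v = 1 - ε) ↦ ((continuousAt_coneExtension (h t v)
            (by linarith : x.1 v < 1).ne).comp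
              continuous_subtype_val.continuousAt).continuousWithinAt)
        fun x (hx : x.1 v = 1 - ε) ↦ by
          have hx' : 1 / 2 < x.1 v := by linarith
          rw [AddCircle.coe_sub, hF _ (hmem hx), G.circleMap_mk hh t hx', sub_self]
      exact ⟨n, fun _ ↦ hn⟩
    choose k hk using hslice
    have hvalue (t : T) (v j : Fin 4) (hv : G.vertexPoint t v = G.vertexPoint t₀ v₀)
        (hj : j ≠ v) : ((h t v j + k t v : ℤ) : ℝ) = F (Quot.mk _ ⟨t, edgePoint v j hεI⟩) := by
      have := hk t v hv (edgePoint v j hεI) (by simp [edgePoint, hj.symm])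
      rw [coneExtension_edgePoint _ hj _ hε.ne'] at this
      push_cast
      linarith
    refine ⟨k, fun t i v j hv hvi hjv hji ↦ ?_⟩
    have h1 := hvalue t v j hv hjv
    have h2 := hvalue (G.adj t i) (G.glue t i v) (G.glue t i j)
      ((G.vertexPoint_glue t hvi).trans hv) ((G.glue t i).injective.ne hjv)
    rw [G.mk_edgePoint_glue t hvi hji, ← h1] at h2
    exact_mod_cast h2.symm
  choose k hk using key
  refine ⟨fun t v ↦ k (G.vertexPoint t v) t v, fun t i v j hvi hjv hji ↦ ?_⟩
  simpa only [G.vertexPoint_glue t hvi] using hk _ t i v j rfl hvi hjv hji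

end OrientedGluing

/-! ### Angles -/

theorem Complex.im_one_div_one_sub_pos {w : ℂ} (hw : 0 < w.im) : 0 < (1 / (1 - w)).im := by
  have h : 1 - w ≠ 0 := fun h ↦ by
    have := congrArg Complex.im h
    simp at this
    linarith
  rw [one_div, Complex.inv_im]
  exact div_pos (by simpa using hw) (Complex.normSq_pos.2 h)

theorem Complex.arg_mem_Ioo_of_im_pos {w : ℂ} (hw : 0 < w.im) : w.arg ∈ Set.Ioo 0 Real.pi := by
  refine ⟨lt_of_le_of_ne (Complex.arg_nonneg_iff.2 hw.le) fun h ↦ ?_,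
    Complex.arg_lt_pi_iff.2 (.inr hw.ne')⟩
  exact hw.ne' (Complex.arg_eq_zero_iff.1 h.symm).2

/-- The angles of a Euclidean triangle add up to `π`. -/
theorem Complex.arg_add_arg_add_arg_eq_pi {w : ℂ} (hw : 0 < w.im) :
    w.arg + (1 / (1 - w)).arg + (1 / (1 - 1 / (1 - w))).arg = Real.pi := by
  have h1 := Complex.im_one_div_one_sub_pos hw
  have h2 := Complex.im_one_div_one_sub_pos h1
  have ne_zero {x : ℂ} (hx : 0 < x.im) : x ≠ 0 := fun h ↦ by simp [h] at hx
  have hw0 := ne_zero hw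
  have hw1 : 1 - w ≠ 0 := fun h ↦ ne_zero h1 (by simp [h])
  have hprod : w * (1 / (1 - w)) * (1 / (1 - 1 / (1 - w))) = -1 := by
    have : 1 - 1 / (1 - w) = -w / (1 - w) := by field_simp; ring
    rw [this]
    field_simp
  have hangle : ((w.arg + (1 / (1 - w)).arg + (1 / (1 - 1 / (1 - w))).arg : ℝ) : Real.Angle) =
      (Real.pi : ℝ) := by
    rw [Real.Angle.coe_add, Real.Angle.coe_add, ← Complex.arg_mul_coe_angle hw0 (ne_zero h1),
      ← Complex.arg_mul_coe_angle (mul_ne_zero hw0 (ne_zero h1)) (ne_zero h2), hprod,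
      Complex.arg_neg_one]
  obtain ⟨n, hn⟩ := Real.Angle.angle_eq_iff_two_pi_dvd_sub.1 hangle
  have a0 := Complex.arg_mem_Ioo_of_im_pos hw
  have a1 := Complex.arg_mem_Ioo_of_im_pos h1
  have a2 := Complex.arg_mem_Ioo_of_im_pos h2
  have hpi := Real.pi_pos
  have hn1 : n < 1 := by
    by_contra! h
    have : (1 : ℝ) ≤ n := by exact_mod_cast h
    nlinarith [a0.2, a1.2, a2.2]
  have hn2 : -1 < n := by
    by_contra! h
    have : (n : ℝ) ≤ -1 := by exact_mod_cast h
    nlinarith [a0.1, a1.1, a2.1]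
  obtain rfl : n = 0 := by omega
  rw [Int.cast_zero, mul_zero] at hn
  linarith

theorem Complex.coe_sum_mul_arg {ι : Type*} (s : Finset ι) {z : ι → ℂ} (hz : ∀ i, z i ≠ 0)
    (n : ι → ℕ) : ((∑ i ∈ s, n i * (z i).arg : ℝ) : Real.Angle) = (∏ i ∈ s, z i ^ n i).arg := by
  classical
  induction s using Finset.induction_on with
  | empty => simp
  | insert a s ha ih =>
    rw [Finset.sum_insert ha, Finset.prod_insert ha,
      Complex.arg_mul_coe_angle (pow_ne_zero _ (hz a))
      (Finset.prod_ne_zero_iff.2 fun i _ ↦ pow_ne_zero _ (hz i)), Real.Angle.coe_add, ih,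
      Complex.arg_pow_coe_angle, ← nsmul_eq_mul, Real.Angle.coe_nsmul]

namespace OrientedGluing

variable {T : Type*} (G : OrientedGluing T)

theorem sum_index_le [Fintype T] [Fintype G.Edge] (q : T × Fin 3) : ∑ e, G.index q e ≤ 2 := by
  classical
  have hF : {f : SimplexEdge | Faces q.2 f}.ncard ≤ 2 := by
    have hsub : Subtype.val '' {f : SimplexEdge | Faces q.2 f} ⊆
        ({{0, q.2.succ}, {0, q.2.succ}ᶜ} : Set (Finset (Fin 4))) := by
      rintro _ ⟨f, hf, rfl⟩
      exact hf
    rw [← Set.ncard_image_of_injective _ Subtype.val_injective]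
    exact (Set.ncard_le_ncard hsub).trans ((Set.ncard_insert_le _ _).trans (by simp))
  refine le_trans (le_of_eq ?_) hF
  rw [Set.ncard_eq_toFinset_card',
    Finset.card_eq_sum_card_fiberwise (f := fun f ↦ (Quot.mk _ (q.1, f) : G.Edge))
      (t := Finset.univ) (by simp)]
  refine Finset.sum_congr rfl fun e _ ↦ ?_
  rw [index, Set.ncard_eq_toFinset_card']
  congr 1
  ext f
  simp

theorem exists_index_ne_zero (e : G.Edge) : ∃ q, G.index q e ≠ 0 := by
  induction e using Quot.ind with
  | mk p =>
    obtain ⟨t, f⟩ := p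
    obtain ⟨k, hk⟩ : ∃ k : Fin 3, Faces k f := by
      have : ∀ f : SimplexEdge, ∃ k : Fin 3,
        f.1 = {0, k.succ} ∨ f.1 = ({0, k.succ} : Finset (Fin 4))ᶜ := by decide
      exact this f
    exact ⟨(t, k), Set.ncard_ne_zero_of_mem (a := f) ⟨hk, rfl⟩⟩

/-- If all shape parameters lie in the upper half-plane, then the angles around each edge add up to
at least `2π`, while those of each tetrahedron add up to `2π`. -/
theorem card_edge_le_of_im_pos [Fintype T] {z : T × Fin 3 → ℂ} (hz : z ∈ G.parameterSpace)
    (him : ∀ q, 0 < (z q).im) : Nat.card G.Edge ≤ Fintype.card T := by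
  classical
  have : Fintype G.Edge := Fintype.ofFinite _
  obtain ⟨hz0, hedge, htau⟩ := hz
  have harg (q) := Complex.arg_mem_Ioo_of_im_pos (him q)
  have h1 (e : G.Edge) : 2 * Real.pi ≤ ∑ q, G.index q e * (z q).arg := by
    have hsum := Complex.coe_sum_mul_arg Finset.univ (fun q ↦ (hz0 q).1) fun q ↦ G.index q e
    rw [hedge e, Complex.arg_one] at hsum
    obtain ⟨n, hn⟩ := Real.Angle.angle_eq_iff_two_pi_dvd_sub.1 hsum
    rw [sub_zero] at hn
    obtain ⟨q, hq⟩ := G.exists_index_ne_zero e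
    have hpos : 0 < ∑ q, G.index q e * (z q).arg :=
      Finset.sum_pos' (fun q _ ↦ mul_nonneg (Nat.cast_nonneg _) (harg q).1.le)
        ⟨q, Finset.mem_univ q, mul_pos (by positivity) (harg q).1⟩
    rw [hn] at hpos ⊢
    have hn0 : 0 < n := by exact_mod_cast pos_of_mul_pos_right hpos Real.two_pi_pos.le
    have : (1 : ℝ) ≤ n := by exact_mod_cast hn0
    nlinarith [Real.pi_pos]
  have h2 (t : T) : ∑ k, (z (t, k)).arg = Real.pi := by
    have e1 : z (t, 1) = 1 / (1 - z (t, 0)) := htau (t, 0)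
    have e2 : z (t, 2) = 1 / (1 - z (t, 1)) := htau (t, 1)
    rw [Fin.sum_univ_three, e2, e1]
    exact Complex.arg_add_arg_add_arg_eq_pi (him _)
  have h3 : (Fintype.card G.Edge : ℝ) * (2 * Real.pi) ≤ Fintype.card T * (2 * Real.pi) :=
    calc (Fintype.card G.Edge : ℝ) * (2 * Real.pi) = ∑ _e : G.Edge, 2 * Real.pi := by simp
      _ ≤ ∑ e, ∑ q, G.index q e * (z q).arg := Finset.sum_le_sum fun e _ ↦ h1 e
      _ = ∑ q, ((∑ e, G.index q e : ℕ) : ℝ) * (z q).arg := by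
        rw [Finset.sum_comm]
        simp only [Nat.cast_sum, Finset.sum_mul]
      _ ≤ ∑ q, 2 * (z q).arg := Finset.sum_le_sum fun q _ ↦
        mul_le_mul_of_nonneg_right (by exact_mod_cast G.sum_index_le q) (harg q).1.le
      _ = Fintype.card T * (2 * Real.pi) := by
        rw [← Finset.mul_sum, Fintype.sum_prod_type]
        simp [h2]
        ring
  rw [Nat.card_eq_fintype_card]
  exact_mod_cast le_of_mul_le_mul_right h3 Real.two_pi_pos

end OrientedGluing

theorem mainTheorem6 {M : Type*} [TopologicalSpace M] [T2Space M] [CompactSpace M] [Nonempty M]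
    [ChartedSpace (EuclideanSpace ℝ (Fin 3)) M]
    {T : Type*} [Fintype T] (𝒯 : OrientedTriangulation T M)
    (z : T × Fin 3 → ℂ) (hz : z ∈ 𝒯.parameterSpace) :
    ∃ σ : T, ∀ k : Fin 3, z (σ, k) ∈ closure {w : ℂ | w.im < 0} := by
  by_contra! h
  have him : ∀ q, 0 < (z q).im := by
    rintro ⟨t, l⟩
    obtain ⟨k, hk⟩ := h t
    rw [Complex.closure_setOfPred_im_lt] at hk
    have hk0 : 0 < (z (t, k)).im := not_le.1 hk
    have hstep (k : Fin 3) (hk : 0 < (z (t, k)).im) : 0 < (z (t, k + 1)).im := by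
      rw [show z (t, k + 1) = 1 / (1 - z (t, k)) from hz.2.2 (t, k)]
      exact Complex.im_one_div_one_sub_pos hk
    have hl : l = k ∨ l = k + 1 ∨ l = k + 1 + 1 := by omega
    rcases hl with rfl | rfl | rfl
    · exact hk0
    · exact hstep _ hk0
    · exact hstep _ (hstep _ hk0)
  have : Nonempty T := by
    obtain ⟨r⟩ := Nonempty.map 𝒯.homeo.symm ‹Nonempty M›
    obtain ⟨p, -⟩ := Quot.exists_rep r
    exact ⟨p.1⟩
  have h1 := 𝒯.card_lt_card_edge fun _ hh ↦ hh.isLinkCoboundary 𝒯.homeo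
  have h2 := 𝒯.card_edge_le_of_im_pos hz him
  omega
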